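/- All graphs are finite with non-empty vertex set. A \emph{signed bi-graph} is a loopless multigraph with a sign $\sigma(e)\in\{1,-1\}$ on every edge, having between any two distinct vertices at most one positive and at most one negative edge; a \emph{signed graph} $(G,\sigma)$ is a simple graph $G$ with a map $\sigma\colon E(G)\to\{1,-1\}$, i.e. a signed bi-graph without multiple edges. For $k\ge 1$, a $k$-coloring of a signed bi-graph is a map $c\colon V\to\mathbb{Z}/k\mathbb{Z}$ with $c(v)\neq\sigma(e)c(w)$ for each edge $e=vw$, and the chromatic number is the smallest $k\ge1$ for which a $k$-coloring exists. $(K_q,+)$ denotes the complete graph on $q$ vertices with all edges positive. For an integer $k\ge 0$, a signed bi-graph is \emph{$k$-thin} if it arises from a bi-complete one (a positive and a negative edge between any two distinct vertices) by deleting at most $k$ pairwise vertex-disjoint edges. Consider the following operations on signed bi-graphs, where parallel edges of the same sign that arise are merged into one: (sb1) Add vertices or signed edges. (sb2) Identify two nonadjacent vertices. (sb3) From two vertex-disjoint signed bi-graphs $G_1,G_2$, a vertex $v$ of $G_1$ and a positive edge $e=xy$ of $G_2$: split $v$ into two new vertices $v_1,v_2$ (each edge at $v$ becomes an edge of the same sign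 at exactly one of $v_1,v_2$), remove $e$, and identify $v_1$ with $x$ and $v_2$ with $y$. (sb4) Switch at a vertex $v$, i.e. change the sign of every edge incident to $v$. (sb5), for an integer $p\ge 1$, applied to a signed bi-graph that is not $p$-colorable: if $p$ is even, remove a vertex that has at most $p/2$ neighbors; if $p\ge3$ is odd, remove a negative edge whose ends are connected by no other edge, identify its two ends, and add signed edges so that the resulting signed bi-graph is $\frac{p-3}{2}$-thin. Theorem. Every signed graph with chromatic number $q$ can be obtained, up to isomorphism, from copies of $(K_q,+)$ by finitely many applications of (sb1)--(sb4) and of (sb5) with parameters $p\ge q-1$. -/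

import Mathlib

universe u

/-- A signed bi-graph: no loops, and between two distinct vertices at most one edge of each sign.
`G.edge s` is the simple graph formed by the edges of sign `s`, where `ℤˣ = {1, -1}`. -/
@[ext]
structure SignedBigraph (V : Type u) where
  edge : ℤˣ → SimpleGraph V

/-- A signed graph `(G, σ)`: a simple graph with a sign on every edge. -/
structure SignedGraph (V : Type u) where
  graph : SimpleGraph V
  sign : graph.edgeSet → ℤˣ

/-- A signed graph regarded as a signed bi-graph. -/
def SignedGraph.toSignedBigraph {V : Type u} (G : SignedGraph V) : SignedBigraph V where
  edge s :=
    { Adj := fun a b => ∃ h : s(a, b) ∈ G.graph.edgeSet, G.sign ⟨s(a, b), h⟩ = s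
      symm := ⟨fun a b => by rw [Sym2.eq_swap (a := b) (b := a)]; exact id⟩
      loopless := ⟨fun _ h => G.graph.loopless.irrefl _ h.1⟩ }

namespace SignedBigraph

variable {V : Type u} {W : Type u}

/-- `c : V → ℤ/k` is a `k`-coloring if `c v ≠ σ(e) c w` for each edge `e = vw`. -/
def IsColoring (G : SignedBigraph V) (k : ℕ) (c : V → ZMod k) : Prop :=
  ∀ (s : ℤˣ) (v w : V), (G.edge s).Adj v w → c v ≠ ((s : ℤ) : ZMod k) * c w

def Colorable (G : SignedBigraph V) (k : ℕ) : Prop :=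
  ∃ c : V → ZMod k, G.IsColoring k c

/-- `q` is the chromatic number: the smallest positive `k` such that a `k`-coloring exists. -/
def HasChromaticNumber (G : SignedBigraph V) (q : ℕ) : Prop :=
  IsLeast {k : ℕ | 0 < k ∧ G.Colorable k} q

/-- The complete graph on `V` with all edges positive. -/
def completePos (V : Type u) : SignedBigraph V where
  edge s := if s = 1 then ⊤ else ⊥

/-- The set of vertices joined to `u` by an edge of some sign. -/
def neighbors (G : SignedBigraph V) (u : V) : Set V :=
  {w | ∃ s : ℤˣ, (G.edge s).Adj u w}

/-- `G` is `k`-thin: the signed edges missing from the bi-complete signed bi-graph on `V` are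
pairwise vertex-disjoint, and there are at most `k` of them. -/
def IsThin (G : SignedBigraph V) (k : ℕ) : Prop :=
  (∀ (a b b' : V) (s s' : ℤˣ), (G.edge s)ᶜ.Adj a b → (G.edge s')ᶜ.Adj a b' → b = b' ∧ s = s') ∧
    ∑ s : ℤˣ, (G.edge s)ᶜ.edgeSet.ncard ≤ k

/-- `f : V → W` presents `W` as the vertex set obtained from `V` by identifying the two distinct
vertices `x` and `y`, and no others. -/
structure Identifies (f : V → W) (x y : V) : Prop where
  ne : x ≠ y
  surj : Function.Surjective f
  eq_iff : ∀ a b : V, f a = f b ↔ a = b ∨ (a = x ∧ b = y) ∨ (a = y ∧ b = x)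

/-- The image of `G` under a map of the vertices. Parallel edges of the same sign are merged, and
an edge whose ends get the same image is dropped. -/
def image (G : SignedBigraph V) (f : V → W) : SignedBigraph W where
  edge s :=
    { Adj := fun a b => a ≠ b ∧ ∃ u v : V, (G.edge s).Adj u v ∧ f u = a ∧ f v = b
      symm := ⟨fun _ _ ⟨hne, u, v, h, hu, hv⟩ => ⟨hne.symm, v, u, h.symm, hv, hu⟩⟩
      loopless := ⟨fun _ h => h.1 rfl⟩ }

/-- Delete the vertex `v`. -/
def deleteVertex (G : SignedBigraph V) (v : V) : SignedBigraph {w : V // w ≠ v} where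
  edge s := (G.edge s).comap Subtype.val

open Classical in
/-- The sign change that switching at `v` causes on an edge with ends `a` and `b`: it is `-1` if
exactly one of the ends is `v`, and `1` otherwise. -/
noncomputable def switchSign (v a b : V) : ℤˣ :=
  (if a = v then -1 else 1) * (if b = v then -1 else 1)

/-- Switch at the vertex `v`: the edges incident to `v` change sign. -/
def switch (G : SignedBigraph V) (v : V) : SignedBigraph V where
  edge s :=
    { Adj := fun a b => (G.edge (switchSign v a b * s)).Adj a b
      symm := ⟨fun a b h => by
        have e : switchSign v b a = switchSign v a b := mul_comm _ _
        rw [e]; exact h.symm⟩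
      loopless := ⟨fun a h => (G.edge _).loopless.irrefl a h⟩ }

/-- Adjacency by an edge of sign `s` in `splice G₁ v G₂ x y P`. -/
def SpliceAdj (G₁ : SignedBigraph V) (v : V) (G₂ : SignedBigraph W) (x y : W)
    (P : ℤˣ → V → Prop) (s : ℤˣ) : {a : V // a ≠ v} ⊕ W → {a : V // a ≠ v} ⊕ W → Prop
  | .inl a, .inl b => (G₁.edge s).Adj a b
  | .inl a, .inr b => (G₁.edge s).Adj v a ∧ ((b = x ∧ P s a) ∨ (b = y ∧ ¬ P s a))
  | .inr b, .inl a => (G₁.edge s).Adj v a ∧ ((b = x ∧ P s a) ∨ (b = y ∧ ¬ P s a))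
  | .inr a, .inr b => (G₂.edge s).Adj a b ∧ ¬ (s = 1 ∧ s(a, b) = s(x, y))

/-- Take the disjoint union of `G₁` and `G₂`, split the vertex `v` of `G₁` into two vertices `v₁`
and `v₂`, remove the positive edge `xy` of `G₂`, and identify `v₁` with `x` and `v₂` with `y`.
Each edge at `v` goes to exactly one of `v₁`, `v₂`: the edge `va` of sign `s` goes to `v₁` if
`P s a` holds and to `v₂` otherwise. -/
def splice (G₁ : SignedBigraph V) (v : V) (G₂ : SignedBigraph W) (x y : W)
    (P : ℤˣ → V → Prop) : SignedBigraph ({a : V // a ≠ v} ⊕ W) where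
  edge s :=
    { Adj := SpliceAdj G₁ v G₂ x y P s
      symm := ⟨fun a b h => by
        rcases a with a | a <;> rcases b with b | b
        · exact (G₁.edge s).symm.symm _ _ h
        · exact h
        · exact h
        · exact ⟨h.1.symm, fun e => h.2 ⟨e.1, by rw [Sym2.eq_swap]; exact e.2⟩⟩⟩
      loopless := ⟨fun a h => by
        rcases a with a | a
        · exact (G₁.edge s).loopless.irrefl _ h
        · exact (G₂.edge s).loopless.irrefl _ h.1⟩ }

/-- `Obtainable q G`: the finite signed bi-graph `G` can be obtained from copies of the
all-positive complete graph of order `q` by the operations (sb1)-(sb5). The operation (sb5) depends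
on a positive integer `p` and acts on signed bi-graphs that are not `p`-colorable; it may be used
here for every `p ≥ q - 1`. -/
inductive Obtainable (q : ℕ) : {V : Type u} → SignedBigraph V → Prop
  | base {V : Type u} [Finite V] (hV : Nat.card V = q) : Obtainable q (completePos V)
  /-- (sb1) Add vertices or signed edges: `H` contains a copy of `G`. -/
  | sb1 {V W : Type u} [Finite W] (G : SignedBigraph V) (H : SignedBigraph W) (f : V ↪ W)
      (hf : ∀ (s : ℤˣ) (a b : V), (G.edge s).Adj a b → (H.edge s).Adj (f a) (f b))
      (hG : Obtainable q G) : Obtainable q H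
  /-- (sb2) Identify two nonadjacent vertices. -/
  | sb2 {V W : Type u} (G : SignedBigraph V) (x y : V) (hxy : y ∉ G.neighbors x)
      (f : V → W) (hf : Identifies f x y)
      (hG : Obtainable q G) : Obtainable q (G.image f)
  /-- (sb3) Splice two graphs at a vertex `v` of the first and a positive edge of the second. -/
  | sb3 {V W : Type u} (G₁ : SignedBigraph V) (v : V) (G₂ : SignedBigraph W) (x y : W)
      (hxy : (G₂.edge 1).Adj x y) (P : ℤˣ → V → Prop)
      (hG₁ : Obtainable q G₁) (hG₂ : Obtainable q G₂) : Obtainable q (splice G₁ v G₂ x y P)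
  /-- (sb4) Switch at a vertex. -/
  | sb4 {V : Type u} (G : SignedBigraph V) (v : V)
      (hG : Obtainable q G) : Obtainable q (G.switch v)
  /-- (sb5), `p` even: remove a vertex that has at most `p / 2` neighbors. -/
  | sb5_even {V : Type u} (G : SignedBigraph V) (p : ℕ) (hp : 0 < p) (hq : q ≤ p + 1)
      (heven : Even p) (hcol : ¬ G.Colorable p) (v : V) (hv : (G.neighbors v).ncard ≤ p / 2)
      (hG : Obtainable q G) : Obtainable q (G.deleteVertex v)
  /-- (sb5), `p = 2 k + 3` odd: remove a negative edge `xy` whose ends are connected by no other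
  edge, identify `x` and `y`, and add signed edges so that the result is `k`-thin, where
  `k = (p - 3) / 2`. -/
  | sb5_odd {V W : Type u} (G : SignedBigraph V) (p k : ℕ) (hp : p = 2 * k + 3) (hq : q ≤ p + 1)
      (hcol : ¬ G.Colorable p) (x y : V)
      (hneg : (G.edge (-1)).Adj x y) (hpos : ¬ (G.edge 1).Adj x y)
      (f : V → W) (hf : Identifies f x y) (H : SignedBigraph W)
      (hH : ∀ s : ℤˣ, (G.image f).edge s ≤ H.edge s) (hthin : H.IsThin k)
      (hG : Obtainable q G) : Obtainable q H

end SignedBigraph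

/-! The argument gives more: every signed bi-graph that is not `p`-colorable, `p ≥ 1`, is obtainable
from `(K_{p+1}, +)`. Obtainability passes to homomorphic images up to switching, so a signed Hajós
construction applies: in an edge-maximal non-obtainable graph, missing signed edges compose
(`exists_saturated`). Missing some edge is then an equivalence relation. Distinct classes are joined
by all edges of both signs, and up to switching each class is either edgeless or complete with all
edges negative.

Let there be `a` classes, `b` of them with edges. One vertex per class, and a second one in each
class with edges, form a positive clique up to switching, so `a + b ≤ p`. On the other hand, a
coloring arises by giving the classes colors distinct modulo sign, with `c ≠ -c` on classes with
edges. Modulo sign there are `⌊p/2⌋ + 1` colors, and `⌊(p-1)/2⌋` of them satisfy `c ≠ -c`.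

If `a > ⌊p/2⌋ + 1`, the representatives are bi-complete and odd (sb5) applies
(`obtainable_of_biComplete`). Otherwise non-colorability forces `p = 2k` and `a = b = k`. A class
with at most two vertices could take the two colors `0` and `k`, so all classes have at least three
vertices. Even (sb5), deleting an auxiliary vertex, settles this case (`obtainable_of_three_le`). -/

namespace SignedBigraph

/-! ### Homomorphisms, switching and cliques -/

variable {V W : Type u} {q : ℕ}

theorem Obtainable.finite {G : SignedBigraph V} (h : Obtainable q G) : Finite V := by
  induction h with
  | base _ => assumption
  | sb1 => assumption
  | sb2 G x y hxy f hf hG ih => exact Finite.of_surjective f hf.surj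
  | sb3 => infer_instance
  | sb4 _ _ _ ih => exact ih
  | sb5_even => infer_instance
  | sb5_odd G p k hp hq hcol x y hneg hpos f hf H hH hthin hG ih =>
    exact Finite.of_surjective f hf.surj

/-- A homomorphic image of an obtainable signed bi-graph is obtainable. -/
theorem Obtainable.hom [Finite W] {G : SignedBigraph V} (hG : Obtainable q G)
    (H : SignedBigraph W) (f : V → W)
    (hf : ∀ s a b, (G.edge s).Adj a b → (H.edge s).Adj (f a) (f b)) : Obtainable q H := by
  have := hG.finite
  induction hn : Nat.card V generalizing V with
  | zero =>
    have : IsEmpty V := (Nat.card_eq_zero.1 hn).resolve_right (fun h => h.not_finite ‹_›)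
    exact .sb1 G H ⟨f, fun a => isEmptyElim a⟩ hf hG
  | succ n ih =>
    by_cases hinj : Function.Injective f
    · exact .sb1 G H ⟨f, hinj⟩ hf hG
    · simp only [Function.Injective, not_forall] at hinj
      obtain ⟨x, y, hxy, hne⟩ := hinj
      classical
      let g : V → {v : V // v ≠ y} := fun v => if h : v = y then ⟨x, hne⟩ else ⟨v, h⟩
      have hgy : g y = ⟨x, hne⟩ := by simp [g]
      have hg : ∀ v (h : v ≠ y), g v = ⟨v, h⟩ := fun v h => by simp [g, h]
      have hfg : ∀ v, f (g v).1 = f v := by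
        intro v
        by_cases h : v = y
        · subst h; rw [hgy, hxy]
        · rw [hg v h]
      have hid : Identifies g x y := by
        refine ⟨hne, fun v => ⟨v.1, hg v.1 v.2⟩, fun a b => ?_⟩
        by_cases ha : a = y <;> by_cases hb : b = y
        · simp [ha, hb]
        · subst ha; rw [hgy, hg b hb]; simp only [Subtype.mk.injEq]; grind
        · subst hb; rw [hgy, hg a ha]; simp only [Subtype.mk.injEq]; grind
        · rw [hg a ha, hg b hb]; simp only [Subtype.mk.injEq]; grind
      -- `H` is loopless, so vertices with a common image are nonadjacent.
      have hnon : y ∉ G.neighbors x := by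
        rintro ⟨s, hs⟩
        exact (hf s x y hs).ne hxy
      refine ih (.sb2 G x y hnon g hid hG) (fun v => f v.1) ?_ inferInstance ?_
      · rintro s a b ⟨-, u, v, huv, rfl, rfl⟩
        rw [hfg, hfg]
        exact hf s u v huv
      · have := Nat.card_congr (Equiv.sumCompl (fun v : V => v = y))
        rw [Nat.card_sum, hn] at this
        simp at this
        simpa using (by omega : Nat.card {v : V // ¬ v = y} = n)

/-- Switch at all vertices `v` with `τ v = -1`. -/
def switchBy (G : SignedBigraph V) (τ : V → ℤˣ) : SignedBigraph V where
  edge s :=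
    { Adj := fun a b => (G.edge (τ a * τ b * s)).Adj a b
      symm := ⟨fun a b h => by rw [mul_comm (τ b)]; exact h.symm⟩
      loopless := ⟨fun a h => (G.edge _).loopless.irrefl a h⟩ }

theorem Obtainable.switchBy {G : SignedBigraph V} (hG : Obtainable q G) (τ : V → ℤˣ) :
    Obtainable q (G.switchBy τ) := by
  classical
  have := hG.finite
  have := Fintype.ofFinite V
  induction hn : (Finset.univ.filter fun v => τ v ≠ 1).card generalizing τ with
  | zero =>
    have h1 : ∀ v, τ v = 1 := by
      intro v
      by_contra h
      rw [Finset.card_eq_zero] at hn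
      have : v ∈ Finset.univ.filter fun v => τ v ≠ 1 := by simp [h]
      simp [hn] at this
    convert hG using 1
    ext s a b
    simp [SignedBigraph.switchBy, h1]
  | succ n ih =>
    obtain ⟨v, hv⟩ : (Finset.univ.filter fun v => τ v ≠ 1).Nonempty := by
      rw [← Finset.card_pos]; omega
    have hv' : τ v = -1 := (Int.units_eq_one_or (τ v)).resolve_left (by simpa using hv)
    have key := Obtainable.sb4 _ v (ih (Function.update τ v 1) ?_)
    · convert key using 1
      ext s a b
      simp only [SignedBigraph.switchBy, SignedBigraph.switch, switchSign]
      by_cases ha : a = v <;> by_cases hb : b = v <;> simp [ha, hb, Function.update, hv']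
    · have : (Finset.univ.filter fun w => Function.update τ v 1 w ≠ 1)
          = (Finset.univ.filter fun v => τ v ≠ 1).erase v := by
        ext w
        by_cases hw : w = v <;> simp [hw, Function.update]
      rw [this, Finset.card_erase_of_mem hv, hn]
      rfl

/-- A homomorphic image up to switching of an obtainable signed bi-graph is obtainable. -/
theorem Obtainable.switchHom [Finite W] {G : SignedBigraph V} (hG : Obtainable q G)
    (H : SignedBigraph W) (f : V → W) (τ : V → ℤˣ)
    (hf : ∀ s a b, (G.edge s).Adj a b → (H.edge (τ a * τ b * s)).Adj (f a) (f b)) :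
    Obtainable q H := by
  refine (hG.switchBy τ).hom H f fun s a b h => ?_
  have := hf _ a b h
  rwa [← mul_assoc, Int.units_mul_self, one_mul] at this

/-- A signed bi-graph that contains, up to switching, an all-positive clique of order at least `q`
is obtainable. -/
theorem obtainable_of_clique [Finite V] (G : SignedBigraph V) {K : Type*} [Finite K]
    (hK : q ≤ Nat.card K) (g : K → V) (τ : K → ℤˣ)
    (hg : ∀ i j, i ≠ j → (G.edge (τ i * τ j)).Adj (g i) (g j)) : Obtainable q G := by
  let e : ULift.{u} (Fin q) → K := fun i => (Finite.equivFin K).symm (Fin.castLE hK i.down)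
  have he : Function.Injective e := fun i j h => by
    have := (Finite.equivFin K).symm.injective h
    exact ULift.down_injective (Fin.castLE_injective hK this)
  refine (Obtainable.base (V := ULift.{u} (Fin q)) (by simp)).switchHom G (g ∘ e) (τ ∘ e) ?_
  intro s a b h
  by_cases hs : s = 1
  · subst hs
    simp only [completePos, if_true, SimpleGraph.top_adj] at h
    rw [mul_one]
    exact hg _ _ fun h' => h (he h')
  · simp [completePos, hs] at h

/-! ### The Hajós construction and saturation -/

/-- Add the edge of sign `t` between `x` and `y`. -/
def addEdge (G : SignedBigraph V) (t : ℤˣ) (x y : V) : SignedBigraph V where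
  edge s := G.edge s ⊔ if s = t then SimpleGraph.edge x y else ⊥

theorem addEdge_adj {G : SignedBigraph V} {t : ℤˣ} {x y : V} {s : ℤˣ} {a b : V} :
    ((G.addEdge t x y).edge s).Adj a b ↔ (G.edge s).Adj a b ∨
      s = t ∧ ((a = x ∧ b = y) ∨ (a = y ∧ b = x)) ∧ a ≠ b := by
  by_cases hs : s = t <;> simp [addEdge, hs, SimpleGraph.edge_adj]

/-- Switching by `τ` makes the edges `xy`, `yz` and `xz` positive. The first copy of `y` is split so
that one half keeps only the added edge to `x` and is glued to `z`, while the other half is glued to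
the second `y`. The added edge `xy` thus becomes `xz`, the added edge `yz` is the one removed, and
merging the two copies of each vertex maps the splice into `G`. -/
theorem obtainable_of_addEdge (G : SignedBigraph V) {x y z : V} {s t : ℤˣ}
    (hxy : x ≠ y) (hyz : y ≠ z) (hxz : (G.edge (s * t)).Adj x z)
    (h₁ : Obtainable q (G.addEdge s x y)) (h₂ : Obtainable q (G.addEdge t y z)) :
    Obtainable q G := by
  classical
  have := h₁.finite
  have hne := hxz.ne
  let τ : V → ℤˣ := fun v => if v = x then s else if v = z then t else 1
  have hx : τ x = s := by simp [τ]
  have hy : τ y = 1 := by simp [τ, hxy.symm, hyz]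
  have hz : τ z = t := by simp [τ, hne.symm]
  have hadj : (((G.addEdge t y z).switchBy τ).edge 1).Adj z y := by
    change ((G.addEdge t y z).edge _).Adj z y
    rw [addEdge_adj, hz, hy]
    right
    simp [hyz.symm]
  refine (Obtainable.sb3 _ y _ z y hadj (fun r a => r = 1 ∧ a = x)
    (h₁.switchBy τ) (h₂.switchBy τ)).switchHom G (Sum.elim Subtype.val id)
    (fun v => τ (Sum.elim Subtype.val id v)) ?_
  have hsq : ∀ e : ℤˣ, e * e = 1 := Int.units_mul_self
  have cross : ∀ (r : ℤˣ) (a b : V), a ≠ y →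
      (((G.addEdge s x y).switchBy τ).edge r).Adj y a ∧
        ((b = z ∧ r = 1 ∧ a = x) ∨ (b = y ∧ ¬ (r = 1 ∧ a = x))) →
      (G.edge (τ a * τ b * r)).Adj a b := by
    rintro r a b ha ⟨h, ⟨rfl, rfl, rfl⟩ | ⟨rfl, hP⟩⟩
    · rw [hx, hz, mul_one]; exact hxz
    · change ((G.addEdge s x b).edge (τ b * τ a * r)).Adj b a at h
      rw [addEdge_adj] at h
      rw [mul_comm (τ a)]
      rcases h with h | ⟨h, ⟨h', -⟩ | ⟨-, rfl⟩, -⟩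
      · exact h.symm
      · exact absurd h' hxy.symm
      · rw [hx, hy, one_mul] at h
        exact absurd ⟨by simpa using h, rfl⟩ hP
  rintro r (⟨a, ha⟩ | a) (⟨b, hb⟩ | b) h
  · change ((G.addEdge s x y).edge (τ a * τ b * r)).Adj a b at h
    rw [addEdge_adj] at h
    rcases h with h | ⟨-, ⟨-, h⟩ | ⟨h, -⟩, -⟩
    · exact h
    · exact absurd h hb
    · exact absurd h ha
  · exact cross r a b ha h
  · have := cross r b a hb h
    rw [mul_comm (τ b)] at this
    exact this.symm
  · obtain ⟨h, h'⟩ := h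
    change ((G.addEdge t y z).edge (τ a * τ b * r)).Adj a b at h
    rw [addEdge_adj] at h
    rcases h with h | ⟨h, h'', -⟩
    · exact h
    · exfalso
      rcases h'' with ⟨rfl, rfl⟩ | ⟨rfl, rfl⟩
      · rw [hz, hy, one_mul] at h
        exact h' ⟨by simpa using h, Sym2.eq_swap⟩
      · rw [hz, hy, mul_one] at h
        exact h' ⟨by simpa using h, rfl⟩

/-- Missing signed edges compose. -/
def Saturated (G : SignedBigraph V) : Prop :=
  ∀ (x y z : V) (s t : ℤˣ), x ≠ y → y ≠ z → ¬ (G.edge s).Adj x y → ¬ (G.edge t).Adj y z →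
    ¬ (G.edge (s * t)).Adj x z

/-- A non-obtainable signed bi-graph is contained in a saturated non-obtainable one. -/
theorem exists_saturated [Finite V] (G : SignedBigraph V) (hG : ¬ Obtainable q G) :
    ∃ H : SignedBigraph V, G.edge ≤ H.edge ∧ ¬ Obtainable q H ∧ H.Saturated := by
  obtain ⟨E, hE, hmax⟩ :=
    (Set.toFinite {E : ℤˣ → SimpleGraph V | ¬ Obtainable q ⟨E⟩}).exists_le_maximal (a := G.edge) hG
  refine ⟨⟨E⟩, hE, hmax.prop, ?_⟩
  have key : ∀ (x y : V) (s : ℤˣ), x ≠ y → ¬ (E s).Adj x y →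
      Obtainable q ((⟨E⟩ : SignedBigraph V).addEdge s x y) := by
    intro x y s hxy hs
    by_contra hno
    have hle : E ≤ ((⟨E⟩ : SignedBigraph V).addEdge s x y).edge := fun r => le_sup_left
    have := hmax.le_of_ge (y := ((⟨E⟩ : SignedBigraph V).addEdge s x y).edge) hno hle s
    exact hs (this (addEdge_adj.2 (Or.inr ⟨rfl, Or.inl ⟨rfl, rfl⟩, hxy⟩)))
  intro x y z s t hxy hyz hs ht hst
  exact hmax.prop (obtainable_of_addEdge _ hxy hyz hst (key x y s hxy hs) (key y z t hyz ht))

/-! ### Bi-complete sets via odd (sb5) -/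

/-- The signed bi-graph obtained from the bi-complete one on `n + j` vertices by deleting the
positive edges between `i` and `n + i`. -/
def thinGraph (n j : ℕ) : SignedBigraph (ULift.{u} (Fin (n + j))) where
  edge s :=
    { Adj := fun a b => a ≠ b ∧
        (s = 1 → (a.down : ℕ) ≠ n + b.down ∧ (b.down : ℕ) ≠ n + a.down)
      symm := ⟨fun _ _ h => ⟨h.1.symm, fun hs => (h.2 hs).symm⟩⟩
      loopless := ⟨fun _ h => h.1 rfl⟩ }

/-- A color modulo sign is determined by its least absolute residue, which is at most `p / 2`. -/
theorem card_le_of_biComplete_coloring {ι : Type*} [Finite ι] (p : ℕ) [NeZero p]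
    (c : ι → ZMod p) (hc : ∀ i j, i ≠ j → c i ≠ c j ∧ c i ≠ -c j) : Nat.card ι ≤ p / 2 + 1 := by
  let f : ι → Fin (p / 2 + 1) := fun i =>
    ⟨(c i).valMinAbs.natAbs, Nat.lt_succ_of_le (ZMod.natAbs_valMinAbs_le _)⟩
  have hf : Function.Injective f := by
    intro i j hij
    by_contra hne
    have h := ZMod.natAbs_valMinAbs_eq_natAbs_valMinAbs.1 (Fin.mk.inj_iff.1 hij)
    rcases h with h | h
    · exact (hc i j hne).1 h
    · exact (hc i j hne).2 h
  simpa using Nat.card_le_card_of_injective f hf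

theorem not_colorable_thinGraph (k j : ℕ) :
    ¬ (thinGraph.{u} (k + 3) j).Colorable (2 * k + 3) := by
  rintro ⟨c, hc⟩
  have : NeZero (2 * k + 3) := ⟨by omega⟩
  have h := card_le_of_biComplete_coloring (ι := Fin (k + 3)) (2 * k + 3)
    (fun i => c ⟨Fin.castAdd j i⟩) ?_
  · simp only [Nat.card_eq_fintype_card, Fintype.card_fin] at h
    omega
  · intro i i' hne
    have hadj : ∀ s, ((thinGraph.{u} (k + 3) j).edge s).Adj ⟨Fin.castAdd j i⟩ ⟨Fin.castAdd j i'⟩ := by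
      intro s
      refine ⟨fun h => hne ?_, fun _ => ?_⟩
      · exact Fin.castAdd_injective _ _ (ULift.up_injective h)
      · simp only [Fin.val_castAdd]
        omega
    constructor
    · simpa using hc 1 _ _ (hadj 1)
    · simpa using hc (-1) _ _ (hadj (-1))

theorem isThin_thinGraph {n j k : ℕ} (hjk : j ≤ k) (hjn : j ≤ n) : (thinGraph.{u} n j).IsThin k := by
  have hcompl : ∀ (s : ℤˣ) a b, ((thinGraph.{u} n j).edge s)ᶜ.Adj a b ↔
      a ≠ b ∧ s = 1 ∧ ((a.down : ℕ) = n + b.down ∨ (b.down : ℕ) = n + a.down) := by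
    intro s a b
    rw [SimpleGraph.compl_adj]
    simp only [thinGraph]
    tauto
  constructor
  · intro a b b' s s' h h'
    rw [hcompl] at h h'
    refine ⟨?_, h.2.1.trans h'.2.1.symm⟩
    have := a.down.2
    have := b.down.2
    have := b'.down.2
    apply ULift.down_injective
    apply Fin.ext
    omega
  · have huniv : (Finset.univ : Finset ℤˣ) = {1, -1} := by decide
    rw [huniv, Finset.sum_pair (by decide)]
    have hneg : ((thinGraph.{u} n j).edge (-1))ᶜ.edgeSet = ∅ := by
      ext e
      induction e with | _ a b
      simp [SimpleGraph.mem_edgeSet, -SimpleGraph.compl_adj, hcompl]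
    have hpos : ((thinGraph.{u} n j).edge 1)ᶜ.edgeSet ⊆
        Set.range (fun i : Fin j => (s(⟨⟨i, by omega⟩⟩, ⟨⟨n + i, by omega⟩⟩) :
          Sym2 (ULift.{u} (Fin (n + j))))) := by
      intro e
      induction e with | _ a b
      rw [SimpleGraph.mem_edgeSet, hcompl]
      obtain ⟨⟨a, ha⟩⟩ := a
      obtain ⟨⟨b, hb⟩⟩ := b
      rintro ⟨-, -, h | h⟩
      · simp only at h
        subst h
        exact ⟨⟨b, by omega⟩, Sym2.eq_swap⟩
      · simp only at h
        subst h
        exact ⟨⟨a, by omega⟩, rfl⟩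
    rw [hneg, Set.ncard_empty, add_zero]
    refine (Set.ncard_le_ncard hpos).trans ?_
    rw [← Set.image_univ]
    refine (Set.ncard_image_le).trans ?_
    simpa [Set.ncard_univ] using hjk

/-- With `k + 1` missing edges there are `2 * k + 4` vertices, and switching one side of the missing
matching exposes a positive clique on all of them. Each odd (sb5) contracts one missing pair and
leaves at most `k` missing edges. It stays applicable because `k + 3` bi-complete vertices exceed
the `k + 2` colors modulo sign. -/
theorem obtainable_thinGraph (k : ℕ) (hq : q ≤ 2 * k + 4) :
    ∀ i ≤ k + 1, Obtainable q (thinGraph.{u} (k + 3) (k + 1 - i)) := by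
  intro i
  induction i with
  | zero =>
    intro _
    refine obtainable_of_clique _ (K := ULift.{u} (Fin (k + 3 + (k + 1 - 0)))) ?_ id
      (fun a => if (a.down : ℕ) < k + 3 then 1 else -1) ?_
    · simp only [Nat.card_eq_fintype_card, Fintype.card_ulift, Fintype.card_fin]
      omega
    · intro a b hab
      refine ⟨hab, fun hs => ?_⟩
      have := a.down.2
      have := b.down.2
      simp only [id]
      split_ifs at hs with h₁ h₂ h₂
      · omega
      · exact absurd hs (by decide)
      · exact absurd hs (by decide)
      · omega
  | succ i ih =>
    intro hi
    obtain ⟨j, rfl⟩ : ∃ j, k = i + j := ⟨k - i, by omega⟩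
    have h₁ : i + j + 1 - i = j + 1 := by omega
    have h₂ : i + j + 1 - (i + 1) = j := by omega
    have ih := ih (by omega)
    rw [h₁] at ih
    rw [h₂]
    set n := i + j + 3 with hn
    -- The last vertex `n + j` is merged into its partner `j`.
    let f : ULift.{u} (Fin (n + (j + 1))) → ULift.{u} (Fin (n + j)) := fun a =>
      if h : (a.down : ℕ) < n + j then ⟨⟨a.down, h⟩⟩ else ⟨⟨j, by omega⟩⟩
    have hf : ∀ a, ((f a).down : ℕ) = if (a.down : ℕ) < n + j then (a.down : ℕ) else j := by
      intro a
      simp only [f]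
      split_ifs <;> rfl
    have hext : ∀ {m : ℕ} {a b : ULift.{u} (Fin m)}, a = b ↔ (a.down : ℕ) = b.down := by
      intro m a b
      rw [← Fin.ext_iff]
      exact ULift.down_injective.eq_iff.symm
    refine .sb5_odd _ (2 * (i + j) + 3) (i + j) rfl (by omega)
      (not_colorable_thinGraph (i + j) (j + 1)) ⟨⟨j, by omega⟩⟩ ⟨⟨n + j, by omega⟩⟩ ?_ ?_ f ?_ _ ?_
      (isThin_thinGraph (by omega) (by omega)) ih
    · refine ⟨fun h => ?_, fun h => absurd h (by decide)⟩
      rw [hext] at h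
      simp only at h
      omega
    · exact fun h => (h.2 rfl).2 rfl
    · refine ⟨?_, ?_, ?_⟩
      · rw [ne_eq, hext]
        simp only
        omega
      · intro b
        refine ⟨⟨⟨b.down, by omega⟩⟩, ?_⟩
        rw [hext, hf]
        have := b.down.2
        simp only
        split_ifs
        rfl
      · intro a b
        have := a.down.2
        have := b.down.2
        simp only [hext, hf]
        split_ifs <;> omega
    · rintro s _ _ ⟨hne, a, b, ⟨hab, h⟩, rfl, rfl⟩
      refine ⟨hne, fun hs => ?_⟩
      have := h hs
      have := a.down.2
      have := b.down.2
      rw [ne_eq, hext, hf, hf] at hne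
      rw [hf, hf]
      split_ifs at hne ⊢ <;> omega

/-- A signed bi-graph with a bi-complete set of `k + 3` vertices is obtainable. -/
theorem obtainable_of_biComplete [Finite V] (G : SignedBigraph V) (k : ℕ) (hq : q ≤ 2 * k + 4)
    {K : Type*} [Finite K] (hK : k + 3 ≤ Nat.card K) (g : K → V)
    (hg : ∀ (s : ℤˣ) i j, i ≠ j → (G.edge s).Adj (g i) (g j)) : Obtainable q G := by
  have h := obtainable_thinGraph.{u} k hq (k + 1) le_rfl
  rw [Nat.sub_self] at h
  let e : ULift.{u} (Fin (k + 3 + 0)) → K :=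
    fun i => (Finite.equivFin K).symm (Fin.castLE hK i.down)
  have he : Function.Injective e := fun i j h => by
    have := (Finite.equivFin K).symm.injective h
    exact ULift.down_injective (Fin.castLE_injective hK this)
  exact h.hom G (g ∘ e) fun s a b hab => hg s _ _ fun h' => hab.1 (he h')

/-! ### Structure of saturated signed bi-graphs -/

namespace Saturated

variable {G : SignedBigraph V}

/-- In a saturated signed bi-graph, missing a signed edge is an equivalence relation. -/
def setoid (hG : G.Saturated) : Setoid V where
  r x y := ∃ s, ¬ (G.edge s).Adj x y
  iseqv := by
    refine ⟨fun x => ⟨1, (G.edge 1).loopless.irrefl x⟩, fun ⟨s, hs⟩ => ⟨s, fun h => hs h.symm⟩, ?_⟩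
    rintro x y z ⟨s, hs⟩ ⟨t, ht⟩
    by_cases hxy : x = y
    · subst hxy; exact ⟨t, ht⟩
    by_cases hyz : y = z
    · subst hyz; exact ⟨s, hs⟩
    exact ⟨s * t, hG x y z s t hxy hyz hs ht⟩

theorem mk_eq_iff (hG : G.Saturated) {x y : V} :
    (Quotient.mk hG.setoid x = Quotient.mk hG.setoid y) ↔ ∃ s, ¬ (G.edge s).Adj x y :=
  Quotient.eq

theorem adj_of_mk_ne (hG : G.Saturated) {x y : V}
    (h : Quotient.mk hG.setoid x ≠ Quotient.mk hG.setoid y) (s : ℤˣ) : (G.edge s).Adj x y := by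
  by_contra hs
  exact h (hG.mk_eq_iff.2 ⟨s, hs⟩)

/-- If two distinct vertices of a class are nonadjacent, then so are all vertices of the class. -/
theorem not_adj_of_not_adj (hG : G.Saturated) {x y : V} (hxy : x ≠ y)
    (h : ∀ s, ¬ (G.edge s).Adj x y) {z w : V}
    (hz : Quotient.mk hG.setoid z = Quotient.mk hG.setoid x)
    (hw : Quotient.mk hG.setoid w = Quotient.mk hG.setoid x) (s : ℤˣ) :
    ¬ (G.edge s).Adj z w := by
  -- Both signs are missing between `y` and `x`, so composing through `y` yields a missing edge of
  -- any prescribed sign.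
  have h₁ : ∀ z, Quotient.mk hG.setoid z = Quotient.mk hG.setoid x →
      ∀ s, ¬ (G.edge s).Adj z x := by
    intro z hz s
    by_cases hzy : z = y
    · subst hzy; exact fun h' => h s h'.symm
    · have : Quotient.mk hG.setoid z = Quotient.mk hG.setoid y :=
        hz.trans (hG.mk_eq_iff.2 ⟨1, h 1⟩)
      obtain ⟨t, ht⟩ := hG.mk_eq_iff.1 this
      have := hG z y x t (t * s) hzy hxy.symm ht fun h' => h _ h'.symm
      rwa [← mul_assoc, Int.units_mul_self, one_mul] at this
  by_cases hwx : w = x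
  · subst hwx; exact h₁ z hz s
  by_cases hzx : z = x
  · subst hzx; exact fun h' => h₁ w hw s h'.symm
  have := hG z x w s 1 hzx (Ne.symm hwx) (h₁ z hz s) fun h' => h₁ w hw 1 h'.symm
  rwa [mul_one] at this

/-- The class `c` contains adjacent vertices. -/
def HasEdge (hG : G.Saturated) (c : Quotient hG.setoid) : Prop :=
  ∃ w, Quotient.mk hG.setoid w = c ∧ ∃ s, (G.edge s).Adj c.out w

theorem mk_out (hG : G.Saturated) (c : Quotient hG.setoid) :
    Quotient.mk hG.setoid c.out = c := Quotient.out_eq c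

theorem hasEdge_of_adj (hG : G.Saturated) {v w : V} {s : ℤˣ} (h : (G.edge s).Adj v w)
    (hvw : Quotient.mk hG.setoid v = Quotient.mk hG.setoid w) :
    hG.HasEdge (Quotient.mk hG.setoid v) := by
  by_contra hno
  simp only [HasEdge, not_exists, not_and] at hno
  set r := (Quotient.mk hG.setoid v).out with hr
  have hrv : Quotient.mk hG.setoid r = Quotient.mk hG.setoid v := hG.mk_out _
  by_cases hv : r = v
  · refine hno w hvw.symm s ?_
    rw [hv]; exact h
  · exact hG.not_adj_of_not_adj hv (hno v rfl) hrv.symm (hvw.symm.trans hrv.symm) s h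

theorem exists_adj (hG : G.Saturated) {v w : V} (hne : v ≠ w)
    (hE : hG.HasEdge (Quotient.mk hG.setoid v)) : ∃ s, (G.edge s).Adj v w := by
  by_contra hno
  push Not at hno
  obtain ⟨u, hu, s, hs⟩ := hE
  exact hG.not_adj_of_not_adj hne hno (hG.mk_out _) hu s hs

/-- In a saturated signed bi-graph, the missing edges within the classes are all positive
after a suitable switching. -/
theorem exists_switching (hG : G.Saturated) : ∃ τ : V → ℤˣ, ∀ v w,
    Quotient.mk hG.setoid v = Quotient.mk hG.setoid w → ¬ (G.edge (τ v * τ w)).Adj v w := by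
  classical
  have hex : ∀ v, ∃ s, ¬ (G.edge s).Adj v (Quotient.mk hG.setoid v).out :=
    fun v => hG.mk_eq_iff.1 (hG.mk_out _).symm
  choose σ hσ using hex
  -- Each vertex takes a sign that it misses towards its representative; missing edges compose
  -- through the representative.
  refine ⟨fun v => if v = (Quotient.mk hG.setoid v).out then 1 else σ v, fun v w hvw => ?_⟩
  have hv := hσ v
  have hw := hσ w
  beta_reduce
  rw [← hvw] at hw ⊢
  set r := (Quotient.mk hG.setoid v).out
  split_ifs with h₁ h₂ h₂
  · rw [h₁, h₂]; exact (G.edge _).loopless.irrefl _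
  · rw [one_mul, h₁]; exact fun h => hw h.symm
  · rw [mul_one, h₂]; exact hv
  · exact hG v r w _ _ h₁ (Ne.symm h₂) hv fun h => hw h.symm

/-- Values distinct modulo sign never conflict. After switching, all edges within a class are
negative, so equal values there conflict only if `φ v = -φ v`. -/
theorem colorable_of_map (hG : G.Saturated) {p : ℕ} (φ : V → ZMod p)
    (hφ : ∀ (s : ℤˣ) v w, (G.edge s).Adj v w → (φ v ≠ φ w ∧ φ v ≠ -φ w) ∨
      (Quotient.mk hG.setoid v = Quotient.mk hG.setoid w ∧ φ v = φ w ∧ φ v ≠ -φ v)) :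
    G.Colorable p := by
  obtain ⟨τ, hτ⟩ := hG.exists_switching
  refine ⟨fun v => ((τ v : ℤ) : ZMod p) * φ v, fun s v w h he => ?_⟩
  have hcase := hφ s v w h
  simp only at he
  have hmiss : Quotient.mk hG.setoid v = Quotient.mk hG.setoid w → s ≠ τ v * τ w := by
    intro h' hs
    rw [hs] at h
    exact hτ v w h' h
  rcases Int.units_eq_one_or (τ v) with hv | hv <;> rcases Int.units_eq_one_or (τ w) with hw | hw <;>
    rcases Int.units_eq_one_or s with hs | hs <;>
    simp [hv, hw, hs] at he hmiss <;> grind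

end Saturated

/-! ### Colorings and cliques from counting classes -/

theorem natCast_eq_or_eq_neg {p i j : ℕ} (hp : 0 < p) (hi : i ≤ p / 2) (hj : j ≤ p / 2)
    (h : (i : ZMod p) = j ∨ (i : ZMod p) = -j) : i = j := by
  rcases h with h | h
  · rw [ZMod.natCast_eq_natCast_iff'] at h
    rwa [Nat.mod_eq_of_lt (by omega), Nat.mod_eq_of_lt (by omega)] at h
  · have h' : ((i + j : ℕ) : ZMod p) = 0 := by
      rw [Nat.cast_add, h, neg_add_cancel]
    rw [ZMod.natCast_eq_zero_iff] at h'
    obtain h0 | h0 := Nat.eq_zero_or_pos (i + j)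
    · omega
    · have := Nat.le_of_dvd h0 h'
      omega

theorem natCast_ne_neg_self {p i : ℕ} (hi : 0 < i) (hip : 2 * i < p) : (i : ZMod p) ≠ -i := by
  intro h
  have h' : ((i + i : ℕ) : ZMod p) = 0 := by
    rw [Nat.cast_add]
    nth_rewrite 1 [h]
    rw [neg_add_cancel]
  rw [ZMod.natCast_eq_zero_iff] at h'
  have := Nat.le_of_dvd (by omega) h'
  omega

namespace Saturated

variable {G : SignedBigraph V}

theorem colorable_of_natMap (hG : G.Saturated) {p : ℕ} (hp : 0 < p) (φ : V → ℕ)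
    (hle : ∀ v, φ v ≤ p / 2)
    (hφ : ∀ (s : ℤˣ) v w, (G.edge s).Adj v w → φ v = φ w →
      Quotient.mk hG.setoid v = Quotient.mk hG.setoid w ∧ 0 < φ v ∧ 2 * φ v < p) :
    G.Colorable p := by
  refine hG.colorable_of_map (fun v => (φ v : ZMod p)) fun s v w h => ?_
  by_cases he : φ v = φ w
  · obtain ⟨h₁, h₂, h₃⟩ := hφ s v w h he
    exact Or.inr ⟨h₁, by rw [he], natCast_ne_neg_self h₂ h₃⟩
  · left
    rw [← not_or]
    exact fun h' => he (natCast_eq_or_eq_neg hp (hle v) (hle w) h')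

/-- Classes with edges receive `1, …, b`, none of which is its own negative; edgeless classes
receive `0, b + 1, b + 2, …`, where self-inverse colors are harmless. -/
theorem colorable_of_card_le [Finite V] (hG : G.Saturated) {p : ℕ} (hp : 0 < p)
    (hE : Nat.card {c // hG.HasEdge c} ≤ (p - 1) / 2)
    (hQ : Nat.card (Quotient hG.setoid) ≤ p / 2 + 1) : G.Colorable p := by
  classical
  have hcard := Nat.card_congr (Equiv.sumCompl hG.HasEdge)
  rw [Nat.card_sum] at hcard
  set b := Nat.card {c // hG.HasEdge c}
  set a := Nat.card {c // ¬ hG.HasEdge c}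
  let eB : {c // hG.HasEdge c} ≃ Fin b := Finite.equivFin _
  let eA : {c // ¬ hG.HasEdge c} ≃ Fin a := Finite.equivFin _
  let ψ : Quotient hG.setoid → ℕ := fun c =>
    if h : hG.HasEdge c then eB ⟨c, h⟩ + 1 else if (eA ⟨c, h⟩ : ℕ) = 0 then 0 else b + eA ⟨c, h⟩
  have hB : ∀ c (h : hG.HasEdge c), ψ c = eB ⟨c, h⟩ + 1 := fun c h => by simp [ψ, h]
  have hA : ∀ c (h : ¬ hG.HasEdge c),
      ψ c = if (eA ⟨c, h⟩ : ℕ) = 0 then 0 else b + eA ⟨c, h⟩ := fun c h => by simp [ψ, h]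
  have hinj : Function.Injective ψ := by
    intro c d hcd
    by_cases hc : hG.HasEdge c <;> by_cases hd : hG.HasEdge d
    · rw [hB c hc, hB d hd] at hcd
      simpa using eB.injective (Fin.ext (Nat.succ_injective hcd))
    · have := (eB ⟨c, hc⟩).2
      rw [hB c hc, hA d hd] at hcd
      split_ifs at hcd
      omega
    · have := (eB ⟨d, hd⟩).2
      rw [hA c hc, hB d hd] at hcd
      split_ifs at hcd
      omega
    · rw [hA c hc, hA d hd] at hcd
      have : (eA ⟨c, hc⟩ : ℕ) = eA ⟨d, hd⟩ := by split_ifs at hcd <;> omega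
      simpa using eA.injective (Fin.ext this)
  refine hG.colorable_of_natMap hp (fun v => ψ (Quotient.mk _ v)) (fun v => ?_) ?_
  · by_cases h : hG.HasEdge (Quotient.mk _ v)
    · have := (eB ⟨_, h⟩).2
      rw [hB _ h]
      omega
    · have := (eA ⟨_, h⟩).2
      rw [hA _ h]
      split_ifs <;> omega
  · intro s v w h he
    have he' := hinj he
    have hE' := hG.hasEdge_of_adj h he'
    have := (eB ⟨_, hE'⟩).2
    refine ⟨he', ?_⟩
    simp only [hB _ hE']
    omega

/-- Representatives carry the sign `1`, and the second vertex of a class carries the sign of its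
edge to the representative. Between classes every sign is available. -/
theorem obtainable_of_card_le [Finite V] (hG : G.Saturated)
    (hcard : q ≤ Nat.card (Quotient hG.setoid) + Nat.card {c // hG.HasEdge c}) :
    Obtainable q G := by
  classical
  have hd : ∀ c : {c // hG.HasEdge c}, ∃ (w : V) (s : ℤˣ),
      Quotient.mk hG.setoid w = c.1 ∧ (G.edge s).Adj c.1.out w :=
    fun c => let ⟨w, hw, s, hs⟩ := c.2; ⟨w, s, hw, hs⟩
  choose d t hd ht using hd
  refine obtainable_of_clique G (K := Quotient hG.setoid ⊕ {c // hG.HasEdge c})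
    (by rwa [Nat.card_sum]) (Sum.elim Quotient.out d) (Sum.elim 1 t) ?_
  rintro (c | c) (c' | c') hne
  · exact hG.adj_of_mk_ne (by simpa [mk_out] using hne) _
  · by_cases h : c = c'.1
    · subst h
      simpa using ht c'
    · exact hG.adj_of_mk_ne (by simpa [mk_out, hd] using h) _
  · by_cases h : c.1 = c'
    · subst h
      simpa using (ht c).symm
    · exact hG.adj_of_mk_ne (by simpa [mk_out, hd] using h) _
  · exact hG.adj_of_mk_ne (by simpa [mk_out, hd, Subtype.ext_iff] using hne) _

/-- If there are `k` classes and one of them consists of at most two vertices, then there is a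
`2 k`-coloring that uses the colors `0` and `k` on that class. -/
theorem colorable_of_small_class [Finite V] (hG : G.Saturated) {k : ℕ} (hk : 0 < k)
    (hQ : Nat.card (Quotient hG.setoid) = k) (x y : V)
    (hxy : ∀ v, Quotient.mk hG.setoid v = Quotient.mk hG.setoid x → v = x ∨ v = y) :
    G.Colorable (2 * k) := by
  classical
  let c₀ := Quotient.mk hG.setoid x
  let e : Quotient hG.setoid ≃ Fin k := (Finite.equivFin _).trans (finCongr hQ)
  -- With the class of `x` numbered `0`, the other classes use `1, …, k - 1`, away from the two
  -- self-inverse colors `0` and `k`.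
  let e' := e.trans (Equiv.swap (e c₀) ⟨0, hk⟩)
  have he' : e' c₀ = ⟨0, hk⟩ := by simp [e']
  have hpos : ∀ c, c ≠ c₀ → 0 < (e' c : ℕ) := by
    intro c hc
    rw [Nat.pos_iff_ne_zero]
    intro h
    exact hc (e'.injective (by rw [he']; exact Fin.ext h))
  refine hG.colorable_of_natMap (by omega)
    (fun v => if v = x then 0 else if Quotient.mk hG.setoid v = c₀ then k
      else e' (Quotient.mk hG.setoid v)) (fun v => ?_) ?_
  · have := (e' (Quotient.mk hG.setoid v)).2
    split_ifs <;> omega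
  · intro s v w h he
    have h1 := (e' (Quotient.mk hG.setoid v)).2
    have h2 := (e' (Quotient.mk hG.setoid w)).2
    have h3 := hpos (Quotient.mk hG.setoid v)
    have h4 := hpos (Quotient.mk hG.setoid w)
    have hne := h.ne
    by_cases hv : v = x
    · by_cases hw : w = x
      · exact absurd (hv.trans hw.symm) hne
      · rw [if_pos hv, if_neg hw] at he
        split_ifs at he with h5
        · omega
        · have := h4 h5; omega
    · rw [if_neg hv] at he ⊢
      by_cases hw : w = x
      · rw [if_pos hw] at he
        split_ifs at he with h5
        · omega
        · have := h3 h5; omega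
      · rw [if_neg hw] at he
        by_cases hv' : Quotient.mk hG.setoid v = c₀
        · by_cases hw' : Quotient.mk hG.setoid w = c₀
          · exact absurd (((hxy v hv').resolve_left hv).trans
              ((hxy w hw').resolve_left hw).symm) hne
          · rw [if_pos hv', if_neg hw'] at he; omega
        · rw [if_neg hv'] at he ⊢
          by_cases hw' : Quotient.mk hG.setoid w = c₀
          · rw [if_pos hw'] at he; omega
          · rw [if_neg hw'] at he
            exact ⟨e'.injective (Fin.ext he), h3 hv', by omega⟩

end Saturated

/-! ### The extremal even case via an auxiliary vertex -/

theorem Colorable.comap {G : SignedBigraph V} {H : SignedBigraph W} {p : ℕ} (h : H.Colorable p)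
    (f : V → W) (hf : ∀ s a b, (G.edge s).Adj a b → (H.edge s).Adj (f a) (f b)) :
    G.Colorable p := by
  obtain ⟨c, hc⟩ := h
  exact ⟨c ∘ f, fun s v w hvw => hc s _ _ (hf s v w hvw)⟩

/-- Add a new vertex `none`, joined by both a positive and a negative edge to the vertices
in `S`. -/
def addVertex (G : SignedBigraph V) (S : Set V) : SignedBigraph (Option V) where
  edge s :=
    { Adj := fun a b => (∃ x y, a = some x ∧ b = some y ∧ (G.edge s).Adj x y) ∨
        (a = none ∧ ∃ x ∈ S, b = some x) ∨ (b = none ∧ ∃ x ∈ S, a = some x)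
      symm := ⟨by
        rintro a b (⟨x, y, ha, hb, h⟩ | h | h)
        · exact Or.inl ⟨y, x, hb, ha, h.symm⟩
        · exact Or.inr (Or.inr h)
        · exact Or.inr (Or.inl h)⟩
      loopless := ⟨by
        rintro a (⟨x, y, ha, hb, h⟩ | ⟨h, x, -, h'⟩ | ⟨h, x, -, h'⟩)
        · exact h.ne (Option.some_injective _ (ha.symm.trans hb))
        · simp [h] at h'
        · simp [h] at h'⟩ }

theorem addVertex_adj_some {G : SignedBigraph V} {S : Set V} {s : ℤˣ} {x y : V}
    (h : (G.edge s).Adj x y) : ((G.addVertex S).edge s).Adj (some x) (some y) :=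
  Or.inl ⟨x, y, rfl, rfl, h⟩

theorem obtainable_of_addVertex [Finite V] (G : SignedBigraph V) (S : Set V) {k : ℕ} (hk : 0 < k)
    (hq : q ≤ 2 * k + 1) (hcol : ¬ G.Colorable (2 * k)) (hS : S.ncard ≤ k)
    (h : Obtainable q (G.addVertex S)) : Obtainable q G := by
  refine (Obtainable.sb5_even _ (2 * k) (by omega) hq (even_two_mul k)
    (fun h' => hcol (h'.comap some fun _ _ _ => addVertex_adj_some)) none ?_ h).hom G
    (fun v => v.1.get (Option.isSome_iff_ne_none.2 v.2)) ?_
  · have : (G.addVertex S).neighbors none ⊆ some '' S := by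
      rintro w ⟨s, ⟨x, y, h, -⟩ | ⟨-, x, hx, rfl⟩ | ⟨-, x, -, h⟩⟩
      · simp at h
      · exact ⟨x, hx, rfl⟩
      · simp at h
    refine (Set.ncard_le_ncard this).trans ((Set.ncard_image_le).trans ?_)
    omega
  · rintro s ⟨a, ha⟩ ⟨b, hb⟩ h
    change ((G.addVertex S).edge s).Adj a b at h
    rcases h with ⟨x, y, rfl, rfl, h⟩ | ⟨h, -⟩ | ⟨h, -⟩
    · exact h
    · exact absurd h ha
    · exact absurd h hb

/-- Two vertices per class give a clique of order only `2 * k`. A new vertex is joined doubly to the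
representatives and the result is saturated. If the new vertex becomes doubly joined to everything,
it is the missing clique vertex. Otherwise it misses an edge to some `w`, and saturation forces a
double edge between `w` and the representative of its class; a third vertex of that class then
completes the clique. -/
theorem Saturated.obtainable_of_three_le [Finite V] {G : SignedBigraph V} (hG : G.Saturated)
    {k : ℕ} (hk : 0 < k) (hq : q ≤ 2 * k + 1) (hcol : ¬ G.Colorable (2 * k))
    (hQ : Nat.card (Quotient hG.setoid) = k) (hE : ∀ c, hG.HasEdge c)
    (h3 : ∀ x y, ∃ v, Quotient.mk hG.setoid v = Quotient.mk hG.setoid x ∧ v ≠ x ∧ v ≠ y) :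
    Obtainable q G := by
  classical
  let r : Quotient hG.setoid → V := Quotient.out
  have hr : ∀ c, Quotient.mk hG.setoid (r c) = c := hG.mk_out
  refine obtainable_of_addVertex G (Set.range r) hk hq hcol ?_ ?_
  · rw [← Set.image_univ]
    refine (Set.ncard_image_le).trans ?_
    rw [Set.ncard_univ, hQ]
  by_contra hno
  obtain ⟨H, hle, hH, hsat⟩ := exists_saturated _ hno
  have hsome : ∀ {s x y}, (G.edge s).Adj x y → (H.edge s).Adj (some x) (some y) :=
    fun {s x y} h => hle s (addVertex_adj_some h)
  have hnone : ∀ s c, (H.edge s).Adj none (some (r c)) :=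
    fun s c => hle s (Or.inr (Or.inl ⟨rfl, r c, ⟨c, rfl⟩, rfl⟩))
  have hcard : Nat.card (Option (Quotient hG.setoid × Bool)) = 2 * k + 1 := by
    rw [Finite.card_option, Nat.card_prod, hQ]
    simp [mul_comm]
  -- a clique formed by the `r c`, one further vertex `d c` of each class, and one more vertex
  have clique : ∀ (d : Quotient hG.setoid → V) (t : Quotient hG.setoid → ℤˣ) (u : Option V)
      (ε : ℤˣ), (∀ c, Quotient.mk hG.setoid (d c) = c) →
      (∀ c, (H.edge (t c)).Adj (some (r c)) (some (d c))) →
      (∀ c, (H.edge ε).Adj u (some (r c))) →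
      (∀ c, (H.edge (ε * t c)).Adj u (some (d c))) → False := by
    intro d t u ε hd ht hur hud
    refine hH (obtainable_of_clique H (hq.trans hcard.ge)
      (fun o => o.elim u fun x => some (if x.2 then d x.1 else r x.1))
      (fun o => o.elim ε fun x => if x.2 then t x.1 else 1) ?_)
    rintro (_ | ⟨c, i⟩) (_ | ⟨c', i'⟩) hne
    · exact absurd rfl hne
    · cases i'
      · simpa using hur c'
      · simpa using hud c'
    · cases i
      · simpa using (hur c).symm
      · simpa [mul_comm] using (hud c).symm
    · by_cases hc : c = c'
      · subst hc
        cases i <;> cases i'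
        · exact absurd rfl hne
        · simpa using ht c
        · simpa using (ht c).symm
        · exact absurd rfl hne
      · refine hsome (hG.adj_of_mk_ne ?_ _)
        cases i <;> cases i' <;> simpa [hd, hr] using hc
  choose d hdc t ht using hE
  by_cases hv : ∀ w s, (H.edge s).Adj none (some w)
  · exact clique d t none 1 hdc (fun c => hsome (ht c)) (fun c => hnone 1 c) (fun c => hv _ _)
  · push Not at hv
    obtain ⟨w, s, hs⟩ := hv
    set c₀ := Quotient.mk hG.setoid w with hc₀
    have hwr : ∀ t, (H.edge t).Adj (some w) (some (r c₀)) := by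
      intro t
      by_contra hmiss
      refine hsat none (some w) (some (r c₀)) s t (by simp) ?_ hs hmiss (hnone _ _)
      intro h
      exact hs (h ▸ hnone s c₀)
    have hwne : w ≠ r c₀ := fun h => (hwr 1).ne (congrArg some h)
    obtain ⟨u, huc, huw, hur⟩ := h3 w (r c₀)
    have hE' : ∀ v, hG.HasEdge (Quotient.mk hG.setoid v) := fun v => ⟨d _, hdc _, t _, ht _⟩
    obtain ⟨ε, hε⟩ := hG.exists_adj hur (hE' u)
    obtain ⟨δ, hδ⟩ := hG.exists_adj huw (hE' u)
    -- The double edge between `w` and `r c₀` contains the sign `ε * δ`, for which the triangle with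
    -- `u` switches to all-positive.
    refine clique (Function.update d c₀ w) (Function.update t c₀ (ε * δ)) (some u) ε ?_ ?_ ?_ ?_
    · intro c
      by_cases hc : c = c₀
      · subst hc; simp [hc₀]
      · simp [hc, hdc]
    · intro c
      by_cases hc : c = c₀
      · rw [hc]; simpa using (hwr _).symm
      · simpa [hc] using hsome (ht c)
    · intro c
      by_cases hc : c = c₀
      · rw [hc]; exact hsome hε
      · refine hsome (hG.adj_of_mk_ne ?_ _)
        rw [huc, hr]; exact Ne.symm hc
    · intro c
      by_cases hc : c = c₀
      · rw [hc]
        simp only [Function.update_self]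
        rw [← mul_assoc, Int.units_mul_self, one_mul]
        exact hsome hδ
      · simp only [Function.update_of_ne hc]
        refine hsome (hG.adj_of_mk_ne ?_ _)
        rw [huc, hdc]; exact Ne.symm hc

/-! ### Conclusion -/

/-- Every signed bi-graph that is not `p`-colorable is obtainable from `(K_{p + 1}, +)`. -/
theorem obtainable_of_not_colorable [Finite V] (G : SignedBigraph V) {p : ℕ} (hp : 0 < p)
    (hG : ¬ G.Colorable p) : Obtainable (p + 1) G := by
  by_contra hno
  obtain ⟨H, hle, hH, hsat⟩ := exists_saturated _ hno
  have hcol : ¬ H.Colorable p := fun h => hG (h.comap id fun s _ _ h' => hle s h')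
  have hab : Nat.card (Quotient hsat.setoid) + Nat.card {c // hsat.HasEdge c} ≤ p := by
    by_contra h
    exact hH (hsat.obtainable_of_card_le (by omega))
  have hsub : Nat.card {c // hsat.HasEdge c} ≤ Nat.card (Quotient hsat.setoid) :=
    Nat.card_le_card_of_injective _ Subtype.val_injective
  by_cases hQ : Nat.card (Quotient hsat.setoid) ≤ p / 2 + 1
  · have hE : (p - 1) / 2 < Nat.card {c // hsat.HasEdge c} := by
      by_contra h
      exact hcol (hsat.colorable_of_card_le hp (by omega) hQ)
    -- For odd `p`, `hE` and `hsub` would make the sum in `hab` at least `p + 1`.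
    obtain ⟨k, rfl⟩ : ∃ k, p = 2 * k := ⟨p / 2, by omega⟩
    have hQk : Nat.card (Quotient hsat.setoid) = k := by omega
    have hEk : Nat.card {c // hsat.HasEdge c} = k := by omega
    have hall : ∀ c, hsat.HasEdge c := by
      have hbij := (Nat.bijective_iff_injective_and_card
        (Subtype.val : {c // hsat.HasEdge c} → Quotient hsat.setoid)).2
        ⟨Subtype.val_injective, by rw [hQk, hEk]⟩
      intro c
      obtain ⟨c, rfl⟩ := hbij.2 c
      exact c.2
    refine hH (hsat.obtainable_of_three_le (by omega) le_rfl hcol hQk hall fun x y => ?_)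
    by_contra h
    push Not at h
    refine hcol (hsat.colorable_of_small_class (by omega) hQk x y fun v hv => ?_)
    by_cases hvx : v = x
    · exact Or.inl hvx
    · exact Or.inr (h v hv hvx)
  -- The odd (sb5) parameter `2 * (p / 2 - 1) + 3` is `p` or `p + 1`, by parity; `hab` rules out `p
  -- = 1`, where the subtraction truncates.
  · refine hH (obtainable_of_biComplete H (p / 2 - 1) (by omega)
      (K := Quotient hsat.setoid) (by omega) Quotient.out fun s c c' hne => ?_)
    exact hsat.adj_of_mk_ne (by simpa [Saturated.mk_out] using hne) s

end SignedBigraph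

theorem mainTheorem3 {V : Type u} [Finite V] [Nonempty V] (G : SignedGraph V) (q : ℕ)
    (hq : G.toSignedBigraph.HasChromaticNumber q) :
    SignedBigraph.Obtainable q G.toSignedBigraph := by
  obtain ⟨⟨hpos, -⟩, hmin⟩ := hq
  obtain ⟨p, rfl⟩ : ∃ p, q = p + 1 := ⟨q - 1, by omega⟩
  -- Minimality of `q` concerns positive numbers of colors only, so `p = 0` is separate: any single
  -- vertex is the required clique.
  obtain rfl | hp := Nat.eq_zero_or_pos p
  · exact SignedBigraph.obtainable_of_clique _ (K := Unit) (by simp) (fun _ => Classical.arbitrary V) 1 fun _ _ h => (h rfl).elim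
  · refine SignedBigraph.obtainable_of_not_colorable _ hp fun h => ?_
    have := hmin ⟨hp, h⟩
    omega
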